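/- Let $E,A\in\mathbb{R}^{c\times n}$ and $B\in\mathbb{R}^{c\times m}$, and consider the differential-algebraic equation (DAE) $$\frac{d(Ex)(t)}{dt}=Ax(t)+Bu(t).$$ An interval means $\mathbb{R}$, $[a,+\infty)$, $(-\infty,a]$ or $[a,b]$ with $a<b$. A solution of the DAE on an interval $I$ is a pair $(x,u)\in L^1_{loc}(I,\mathbb{R}^n)\times L^1_{loc}(I,\mathbb{R}^m)$ (each function being Lebesgue integrable on every compact subinterval of $I$) such that $Ex$ is absolutely continuous on every compact subinterval of $I$ and $Ex(t)=Ex(t_0)+\int_{t_0}^{t}(Ax(s)+Bu(s))\,ds$ for all $t_0,t\in I$ with $t_0\le t$. A vector $z\in\mathbb{R}^c$ is differentiably consistent if there are an interval $I$ with $0\in I$ and a solution $(x,u)$ on $I$ with $Ex(0)=z$. The DAE is impulse controllable if for every $x_0\in\mathbb{R}^n$ there is a solution $(x,u)$ on $\mathbb{R}$ with $Ex(0)=Ex_0$ such that $x$ itself is absolutely continuous on every compact interval. Then the following three conditions are equivalent: 1. for every $x_0\in\mathbb{R}^n$, the vector $Ex_0$ is differentiably consistent; 2. the DAE is impulse controllable;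 3. for every matrix $Z$ with $n$ rows such that $\operatorname{im} Z=\ker E$, $\operatorname{rank}\begin{bmatrix}E & A & B\end{bmatrix}=\operatorname{rank}\begin{bmatrix}E & AZ & B\end{bmatrix}$. -/

import Mathlib

open Matrix MeasureTheory

namespace DAE

/-- The admissible time intervals: `ℝ`, `[a, ∞)`, `(-∞, a]`, and `[a, b]` with `a < b`. -/
def IsTimeInterval (I : Set ℝ) : Prop :=
  I = Set.univ ∨ (∃ a, I = Set.Ici a) ∨ (∃ a, I = Set.Iic a) ∨
    ∃ a b, a < b ∧ I = Set.Icc a b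

/-- `f ∈ L¹_loc(I, ℝᵈ)`: `f` is Lebesgue integrable on every compact subinterval of `I`. -/
def LocIntegrable {d : ℕ} (I : Set ℝ) (f : ℝ → Fin d → ℝ) : Prop :=
  ∀ a b : ℝ, Set.Icc a b ⊆ I → IntegrableOn f (Set.Icc a b) volume

/-- `f ∈ AC(I, ℝᵈ)`: `f` is absolutely continuous on every compact subinterval of `I`
(for compact `I` this is absolute continuity on `I` itself). -/
def AbsCont {d : ℕ} (I : Set ℝ) (f : ℝ → Fin d → ℝ) : Prop :=
  ∀ a b : ℝ, a ≤ b → Set.Icc a b ⊆ I → AbsolutelyContinuousOnInterval f a b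

/-- `(x, u)` is a solution on `I` of `d(Ex)/dt = Ax + Bu`: both functions are locally integrable,
`Ex` is absolutely continuous and the integrated equation holds everywhere on `I`.
Only the restrictions of `x` and `u` to `I` matter. -/
structure IsSolution {c n m : ℕ} (E A : Matrix (Fin c) (Fin n) ℝ) (B : Matrix (Fin c) (Fin m) ℝ)
    (I : Set ℝ) (x : ℝ → Fin n → ℝ) (u : ℝ → Fin m → ℝ) : Prop where
  locIntegrable_state : LocIntegrable I x
  locIntegrable_input : LocIntegrable I u
  absCont : AbsCont I fun t => E *ᵥ x t
  integral_eq : ∀ t₀ ∈ I, ∀ t ∈ I, t₀ ≤ t →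
    E *ᵥ x t = E *ᵥ x t₀ + ∫ s in t₀..t, (A *ᵥ x s + B *ᵥ u s)

/-- `z ∈ ℝᶜ` is differentiably consistent: `z = Ex(0)` for some solution on some time interval
containing `0`. -/
def DifferentiablyConsistent {c n m : ℕ} (E A : Matrix (Fin c) (Fin n) ℝ)
    (B : Matrix (Fin c) (Fin m) ℝ) (z : Fin c → ℝ) : Prop :=
  ∃ I : Set ℝ, IsTimeInterval I ∧ (0 : ℝ) ∈ I ∧
    ∃ (x : ℝ → Fin n → ℝ) (u : ℝ → Fin m → ℝ), IsSolution E A B I x u ∧ E *ᵥ x 0 = z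

/-- The set of consistent initial differential variables: those `x₀ ∈ ℝⁿ` with `Ex(0) = Ex₀` for
some solution `(x, u)` on all of `ℝ` whose full state `x` is absolutely continuous. -/
def consistentDiffVars {c n m : ℕ} (E A : Matrix (Fin c) (Fin n) ℝ)
    (B : Matrix (Fin c) (Fin m) ℝ) : Set (Fin n → ℝ) :=
  {x₀ | ∃ (x : ℝ → Fin n → ℝ) (u : ℝ → Fin m → ℝ),
    IsSolution E A B Set.univ x u ∧ AbsCont Set.univ x ∧ E *ᵥ x 0 = E *ᵥ x₀}

/-- Impulse controllability: every `x₀ ∈ ℝⁿ` is a consistent initial differential variable. -/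
def ImpulseControllable {c n m : ℕ} (E A : Matrix (Fin c) (Fin n) ℝ)
    (B : Matrix (Fin c) (Fin m) ℝ) : Prop :=
  consistentDiffVars E A B = Set.univ

end DAE

namespace DAE

/-! All three conditions say that `im A ≤ S`, where `S = im E + A (ker E) + im B`. For the rank
condition this is a dimension count. If `im A ≤ S`, write `A = E Y + A K + B U` with `E K = 0` and
solve `w' = Y w`. Then `x = w - K w`, `u = -U w` is a smooth solution, because `E x = E w` and `A x
+ B u = E Y w`. Conversely, if `A x₀ ∉ S`, some functional `f` kills `S` but not `A x₀`. As `f ∘ A`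
vanishes on `ker E`, it equals `g ∘ E`. Applying `f` to the integrated equation forces `g (E x) =
0`, which at time `0` contradicts `f (A x₀) ≠ 0`. -/

/-- The subspace `im E + A (ker E) + im B`. -/
def impulseSubspace {c n m : ℕ} (E A : Matrix (Fin c) (Fin n) ℝ)
    (B : Matrix (Fin c) (Fin m) ℝ) : Submodule ℝ (Fin c → ℝ) :=
  LinearMap.range E.mulVecLin ⊔
    ((LinearMap.ker E.mulVecLin).map A.mulVecLin ⊔ LinearMap.range B.mulVecLin)

theorem range_mulVecLin_fromCols {c : ℕ} {ι κ : Type*} [Fintype ι] [Fintype κ]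
    (M : Matrix (Fin c) ι ℝ) (N : Matrix (Fin c) κ ℝ) :
    LinearMap.range (fromCols M N).mulVecLin =
      LinearMap.range M.mulVecLin ⊔ LinearMap.range N.mulVecLin := by
  ext v
  simp only [LinearMap.mem_range, Submodule.mem_sup, mulVecLin_apply, fromCols_mulVec]
  constructor
  · rintro ⟨w, rfl⟩
    exact ⟨_, ⟨_, rfl⟩, _, ⟨_, rfl⟩, rfl⟩
  · rintro ⟨_, ⟨x, rfl⟩, _, ⟨y, rfl⟩, rfl⟩
    exact ⟨Sum.elim x y, by simp⟩

theorem rank_eq_iff_range_le {c n m k : ℕ} {E A : Matrix (Fin c) (Fin n) ℝ}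
    {B : Matrix (Fin c) (Fin m) ℝ} {Z : Matrix (Fin n) (Fin k) ℝ}
    (hZ : LinearMap.range Z.mulVecLin = LinearMap.ker E.mulVecLin) :
    (fromCols E (fromCols A B)).rank = (fromCols E (fromCols (A * Z) B)).rank ↔
      LinearMap.range A.mulVecLin ≤ impulseSubspace E A B := by
  have hAZ : LinearMap.range (A * Z).mulVecLin =
      (LinearMap.ker E.mulVecLin).map A.mulVecLin := by
    rw [mulVecLin_mul, LinearMap.range_comp, hZ]
  have hker : (LinearMap.ker E.mulVecLin).map A.mulVecLin ≤ LinearMap.range A.mulVecLin :=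
    LinearMap.map_le_range
  rw [Matrix.rank, Matrix.rank, range_mulVecLin_fromCols, range_mulVecLin_fromCols,
    range_mulVecLin_fromCols, range_mulVecLin_fromCols, hAZ]
  change _ = Module.finrank ℝ (impulseSubspace E A B) ↔ _
  have hle : impulseSubspace E A B ≤ LinearMap.range E.mulVecLin ⊔
      (LinearMap.range A.mulVecLin ⊔ LinearMap.range B.mulVecLin) :=
    sup_le_sup_left (sup_le_sup_right hker _) _
  constructor
  · intro h
    rw [Submodule.eq_of_le_of_finrank_eq hle h.symm]
    exact le_sup_left.trans le_sup_right
  · intro h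
    rw [le_antisymm (sup_le le_sup_left (sup_le h (le_sup_right.trans le_sup_right))) hle,
      impulseSubspace]

/-- The rank condition quantifies over all `Z`, so it has content only once one such `Z` exists; a
projection onto `ker E` serves. -/
theorem exists_range_mulVecLin_eq_ker {c n : ℕ} (E : Matrix (Fin c) (Fin n) ℝ) :
    ∃ Z : Matrix (Fin n) (Fin n) ℝ,
      LinearMap.range Z.mulVecLin = LinearMap.ker E.mulVecLin := by
  obtain ⟨p, hp⟩ := (LinearMap.ker E.mulVecLin).subtype.exists_leftInverse_of_injective
    (Submodule.ker_subtype _)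
  refine ⟨LinearMap.toMatrix' ((LinearMap.ker E.mulVecLin).subtype ∘ₗ p), ?_⟩
  have hsurj : LinearMap.range p = ⊤ :=
    LinearMap.range_eq_top.2 fun v => ⟨v, LinearMap.congr_fun hp v⟩
  rw [← Matrix.toLin'_apply', Matrix.toLin'_toMatrix', LinearMap.range_comp, hsurj,
    Submodule.map_top, Submodule.range_subtype]

theorem exists_linear_decomposition {c n m : ℕ} {E A : Matrix (Fin c) (Fin n) ℝ}
    {B : Matrix (Fin c) (Fin m) ℝ}
    (h : LinearMap.range A.mulVecLin ≤ impulseSubspace E A B) :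
    ∃ (Y K : (Fin n → ℝ) →L[ℝ] Fin n → ℝ) (U : (Fin n → ℝ) →L[ℝ] Fin m → ℝ),
      (∀ v, E *ᵥ K v = 0) ∧ ∀ v, A *ᵥ v = E *ᵥ Y v + (A *ᵥ K v + B *ᵥ U v) := by
  let φ := E.mulVecLin.coprod
    ((A.mulVecLin ∘ₗ (LinearMap.ker E.mulVecLin).subtype).coprod B.mulVecLin)
  have hφ : ∀ v, A.mulVecLin v ∈ LinearMap.range φ := fun v => by
    rw [LinearMap.range_coprod, LinearMap.range_coprod, LinearMap.range_comp,
      Submodule.range_subtype]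
    exact h ⟨v, rfl⟩
  -- Lifting through the surjection onto the range of `φ` makes the three components depend linearly
  -- on `v`.
  obtain ⟨ψ, hψ⟩ := Module.projective_lifting_property φ.rangeRestrict
    (A.mulVecLin.codRestrict _ hφ) φ.surjective_rangeRestrict
  refine ⟨(LinearMap.fst _ _ _ ∘ₗ ψ).toContinuousLinearMap,
    ((LinearMap.ker E.mulVecLin).subtype ∘ₗ LinearMap.fst _ _ _ ∘ₗ
      LinearMap.snd _ _ _ ∘ₗ ψ).toContinuousLinearMap,
    (LinearMap.snd _ _ _ ∘ₗ LinearMap.snd _ _ _ ∘ₗ ψ).toContinuousLinearMap,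
    fun v => (ψ v).2.1.2, fun v => ?_⟩
  exact (congrArg Subtype.val (LinearMap.congr_fun hψ v)).symm

theorem AbsCont.of_contDiff {d : ℕ} {f : ℝ → Fin d → ℝ} (hf : ContDiff ℝ 1 f) (I : Set ℝ) :
    AbsCont I f :=
  fun _ _ _ _ => hf.contDiffOn.absolutelyContinuousOnInterval

theorem LocIntegrable.of_continuous {d : ℕ} {f : ℝ → Fin d → ℝ} (hf : Continuous f)
    (I : Set ℝ) : LocIntegrable I f :=
  fun _ _ _ => hf.integrableOn_Icc

theorem impulseControllable_of_range_le {c n m : ℕ} {E A : Matrix (Fin c) (Fin n) ℝ}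
    {B : Matrix (Fin c) (Fin m) ℝ}
    (h : LinearMap.range A.mulVecLin ≤ impulseSubspace E A B) :
    ImpulseControllable E A B := by
  obtain ⟨Y, K, U, hK, hA⟩ := exists_linear_decomposition h
  refine Set.eq_univ_of_forall fun x₀ => ?_
  let w : ℝ → Fin n → ℝ := fun t => NormedSpace.exp (t • Y) x₀
  have hw : ∀ t, HasDerivAt w (Y (w t)) t := fun t => by
    simpa using (hasDerivAt_exp_smul_const' (𝕂 := ℝ) Y t).clm_apply (hasDerivAt_const t x₀)
  have hwc : Continuous w := continuous_iff_continuousAt.2 fun t => (hw t).continuousAt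
  have hw1 : ContDiff ℝ 1 w := by
    rw [contDiff_one_iff_deriv]
    refine ⟨fun t => (hw t).differentiableAt, ?_⟩
    rw [funext fun t => (hw t).deriv]
    exact Y.continuous.comp hwc
  have hx1 : ContDiff ℝ 1 fun t => w t - K (w t) := hw1.sub (K.contDiff.comp hw1)
  have hEx : ∀ t, E *ᵥ (w t - K (w t)) = E *ᵥ w t := fun t => by
    rw [mulVec_sub, hK, sub_zero]
  let L : (Fin n → ℝ) →L[ℝ] Fin c → ℝ := E.mulVecLin.toContinuousLinearMap
  refine ⟨fun t => w t - K (w t), fun t => -U (w t), ⟨?_, ?_, ?_, ?_⟩, ?_, ?_⟩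
  · exact .of_continuous hx1.continuous _
  · exact .of_continuous (U.continuous.comp hwc).neg _
  · exact .of_contDiff (L.contDiff.comp hx1) _
  · intro t₀ _ t _ _
    have hdyn : ∀ s, A *ᵥ (w s - K (w s)) + B *ᵥ (-U (w s)) = L (Y (w s)) := fun s => by
      change _ = E *ᵥ Y (w s)
      rw [mulVec_sub, mulVec_neg, hA (w s)]
      abel
    simp only [hdyn, hEx]
    rw [intervalIntegral.integral_eq_sub_of_hasDerivAt
      (f := fun s => L (w s)) (fun s _ => L.hasFDerivAt.comp_hasDerivAt s (hw s))
      ((L.continuous.comp (Y.continuous.comp hwc)).intervalIntegrable _ _)]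
    change _ = E *ᵥ w t₀ + (E *ᵥ w t - E *ᵥ w t₀)
    abel
  · exact .of_contDiff hx1 _
  · simp only [hEx]
    simp [w]

/-- The point may be an endpoint of `I`, so only a nondegenerate one-sided neighbourhood is
available. -/
theorem IsTimeInterval.exists_Icc_subset {I : Set ℝ} (hI : IsTimeInterval I) {t : ℝ}
    (ht : t ∈ I) : ∃ a b, a < b ∧ t ∈ Set.Icc a b ∧ Set.Icc a b ⊆ I := by
  rcases hI with rfl | ⟨a, rfl⟩ | ⟨b, rfl⟩ | ⟨a, b, hab, rfl⟩
  · exact ⟨t, t + 1, by simp, by simp, Set.subset_univ _⟩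
  · exact ⟨t, t + 1, by simp, by simp, fun s hs => le_trans ht hs.1⟩
  · exact ⟨t - 1, t, by simp, by simp, fun s hs => le_trans hs.2 ht⟩
  · exact ⟨a, b, hab, ht, subset_rfl⟩

theorem eq_zero_of_forall_integral_eq_zero {g : ℝ → ℝ} {a b : ℝ} (hab : a < b)
    (hg : ContinuousOn g (Set.Icc a b)) (hint : ∀ t ∈ Set.Icc a b, ∫ s in a..t, g s = 0)
    {t : ℝ} (ht : t ∈ Set.Icc a b) : g t = 0 := by
  have : Fact (t ∈ Set.Icc a b) := ⟨ht⟩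
  have hsub : Set.uIcc a t ⊆ Set.Icc a b := by
    rw [Set.uIcc_of_le ht.1]
    exact Set.Icc_subset_Icc_right ht.2
  have h₁ : HasDerivWithinAt (fun r => ∫ s in a..r, g s) (g t) (Set.Icc a b) t :=
    intervalIntegral.integral_hasDerivWithinAt_right (hg.mono hsub).intervalIntegrable
      (hg.stronglyMeasurableAtFilter_nhdsWithin measurableSet_Icc t) (hg t ht)
  have h₂ : HasDerivWithinAt (fun r => ∫ s in a..r, g s) 0 (Set.Icc a b) t :=
    (hasDerivWithinAt_const t _ 0).congr hint (hint t ht)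
  -- Derivatives within `[a, b]` are unique even at its endpoints, since `a < b`.
  exact (uniqueDiffOn_Icc hab t ht).eq_deriv _ h₁ h₂

/-- Applying `f` to the integrated equation leaves `∫ g (E x) = 0` over every `[a, r]`. Although `x`
is merely integrable, `E x` is continuous, so the integrand vanishes at every point and not just
almost everywhere. -/
theorem IsSolution.dual_apply_eq_zero {c n m : ℕ} {E A : Matrix (Fin c) (Fin n) ℝ}
    {B : Matrix (Fin c) (Fin m) ℝ} {I : Set ℝ} {x : ℝ → Fin n → ℝ} {u : ℝ → Fin m → ℝ}
    (h : IsSolution E A B I x u) (hI : IsTimeInterval I) {f g : (Fin c → ℝ) →ₗ[ℝ] ℝ}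
    (hfE : ∀ v, f (E *ᵥ v) = 0) (hfB : ∀ v, f (B *ᵥ v) = 0)
    (hfA : ∀ v, f (A *ᵥ v) = g (E *ᵥ v)) {t : ℝ} (ht : t ∈ I) : g (E *ᵥ x t) = 0 := by
  obtain ⟨a, b, hab, htab, hsub⟩ := hI.exists_Icc_subset ht
  have hcont : ContinuousOn (fun s => E *ᵥ x s) (Set.Icc a b) := by
    have := (h.absCont a b hab.le hsub).continuousOn
    rwa [Set.uIcc_of_le hab.le] at this
  refine eq_zero_of_forall_integral_eq_zero (g := fun s => g (E *ᵥ x s)) hab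
    (g.continuous_of_finiteDimensional.comp_continuousOn hcont) (fun r hr => ?_) htab
  have har : Set.Icc a r ⊆ I := (Set.Icc_subset_Icc_right hr.2).trans hsub
  have hint : IntervalIntegrable (fun s => A *ᵥ x s + B *ᵥ u s) volume a r := by
    rw [intervalIntegrable_iff_integrableOn_Icc_of_le hr.1]
    exact (A.mulVecLin.toContinuousLinearMap.integrable_comp
      (h.locIntegrable_state a r har)).add
      (B.mulVecLin.toContinuousLinearMap.integrable_comp (h.locIntegrable_input a r har))
  have heq := congrArg f (h.integral_eq a (hsub (Set.left_mem_Icc.2 hab.le)) r (hsub hr) hr.1)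
  have hcomm := f.toContinuousLinearMap.intervalIntegral_comp_comm hint
  simp only [LinearMap.coe_toContinuousLinearMap', map_add, hfA, hfB, add_zero] at hcomm
  rw [hcomm]
  rwa [map_add, hfE, hfE, zero_add, eq_comm] at heq

theorem range_le_of_differentiablyConsistent {c n m : ℕ} {E A : Matrix (Fin c) (Fin n) ℝ}
    {B : Matrix (Fin c) (Fin m) ℝ}
    (h : ∀ x₀ : Fin n → ℝ, DifferentiablyConsistent E A B (E *ᵥ x₀)) :
    LinearMap.range A.mulVecLin ≤ impulseSubspace E A B := by
  rintro _ ⟨x₀, rfl⟩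
  by_contra hx₀
  obtain ⟨f, hf, hle⟩ := Submodule.exists_le_ker_of_notMem hx₀
  have hker : f ∘ₗ A.mulVecLin ∈ (LinearMap.ker E.mulVecLin).dualAnnihilator := by
    rw [Submodule.mem_dualAnnihilator]
    exact fun v hv => hle (Submodule.mem_sup_right
      (Submodule.mem_sup_left (Submodule.mem_map_of_mem hv)))
  -- A functional vanishing on `ker E` factors through `E`; this yields `g`.
  rw [← LinearMap.range_dualMap_eq_dualAnnihilator_ker] at hker
  obtain ⟨g, hg⟩ := hker
  have hfA : ∀ v, f (A *ᵥ v) = g (E *ᵥ v) := fun v => (LinearMap.congr_fun hg v).symm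
  obtain ⟨I, hI, h0, x, u, hsol, hx⟩ := h x₀
  apply hf
  rw [mulVecLin_apply, hfA, ← hx]
  exact hsol.dual_apply_eq_zero hI (fun v => hle (Submodule.mem_sup_left ⟨v, rfl⟩))
    (fun v => hle (Submodule.mem_sup_right (Submodule.mem_sup_right ⟨v, rfl⟩))) hfA h0

theorem ImpulseControllable.differentiablyConsistent {c n m : ℕ}
    {E A : Matrix (Fin c) (Fin n) ℝ} {B : Matrix (Fin c) (Fin m) ℝ}
    (h : ImpulseControllable E A B) (x₀ : Fin n → ℝ) :
    DifferentiablyConsistent E A B (E *ᵥ x₀) := by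
  obtain ⟨x, u, hsol, -, hx⟩ : x₀ ∈ consistentDiffVars E A B := h ▸ Set.mem_univ x₀
  exact ⟨Set.univ, Or.inl rfl, Set.mem_univ 0, x, u, hsol, hx⟩

end DAE

theorem mainTheorem12 {c n m : ℕ} (E A : Matrix (Fin c) (Fin n) ℝ)
    (B : Matrix (Fin c) (Fin m) ℝ) :
    List.TFAE
      [ ∀ x₀ : Fin n → ℝ, DAE.DifferentiablyConsistent E A B (E *ᵥ x₀),
        DAE.ImpulseControllable E A B,
        ∀ (k : ℕ) (Z : Matrix (Fin n) (Fin k) ℝ),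
          LinearMap.range Z.mulVecLin = LinearMap.ker E.mulVecLin →
          (Matrix.fromCols E (Matrix.fromCols A B)).rank =
            (Matrix.fromCols E (Matrix.fromCols (A * Z) B)).rank ] := by
  tfae_have 2 → 1 := DAE.ImpulseControllable.differentiablyConsistent
  tfae_have 1 → 3 := fun h _ _ hZ =>
    (DAE.rank_eq_iff_range_le hZ).2 (DAE.range_le_of_differentiablyConsistent h)
  tfae_have 3 → 2 := fun h => by
    obtain ⟨Z, hZ⟩ := DAE.exists_range_mulVecLin_eq_ker E
    exact DAE.impulseControllable_of_range_le ((DAE.rank_eq_iff_range_le hZ).1 (h n Z hZ))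
  tfae_finish
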